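/- Let $J$ be a finite or countable set, let $H$ be a complex Hilbert space, and let $\mathbb A=\{A_j\}_{j\in J}$ and $\mathbb B=\{B_j\}_{j\in J}$ be two families of bounded normal operators on $H$ such that $A_iA_j=A_jA_i$ and $B_iB_j=B_jB_i$ for all $i,j\in J$, and $$\sum_{j\in J}\|A_j\|^2<\infty,\qquad \sum_{j\in J}\|B_j\|^2<\infty .$$ Let $\Delta:B(H)\to B(H)$ be the bounded operator $\Delta(X)=\sum_{j\in J}A_jXB_j$ on the Banach space $B(H)$ of bounded linear operators on $H$, and let $\Delta_{\mathcal C_2}$ be its restriction to the Hilbert space $\mathcal C_2$ of Hilbert--Schmidt operators on $H$, with the Hilbert--Schmidt norm. For a commutative family $\mathbb T=\{T_j\}_{j\in J}$ of bounded normal operators on $H$, let $\sigma(\mathbb T)\subset\mathbb C^J$ denote its joint spectrum, that is, the set of all $(\chi(T_j))_{j\in J}$, where $\chi$ runs over the characters of the commutative unital $C^*$-algebra generated by $\mathbb T$. Then $$\sigma(\Delta)=\Big\{\sum_{j\in J}\lambda_j\mu_j:\ \lambda\in\sigma(\mathbb A),\ \mu\in\sigma(\mathbb B)\Big\}=\sigma(\Delta_{\mathcal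 C_2}),$$ where $\sigma(\Delta)$ and $\sigma(\Delta_{\mathcal C_2})$ are the spectra of $\Delta$ in $B(B(H))$ and of $\Delta_{\mathcal C_2}$ in $B(\mathcal C_2)$, and the series $\sum_j\lambda_j\mu_j$ converge absolutely. -/

import Mathlib

open scoped ENNReal

noncomputable section

namespace MultiplicationOperators

set_option linter.unusedSectionVars false

variable {H : Type*} [NormedAddCommGroup H] [InnerProductSpace ℂ H] [CompleteSpace H]

/-! ### Hilbert-Schmidt operators -/

theorem tsum_enorm_inner_sq {ι : Type*} (b : HilbertBasis ι ℂ H) (x : H) :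
    ∑' i, ‖inner ℂ (b i) x‖ₑ ^ 2 = ‖x‖ₑ ^ 2 := by
  have h := b.hasSum_inner_mul_inner x x
  have h2 : HasSum (fun i => ‖inner ℂ (b i) x‖ ^ 2) (‖x‖ ^ 2) := by
    have h3 := (Complex.hasSum_re h)
    have e : ∀ i, (inner ℂ x (b i) * inner ℂ (b i) x : ℂ).re = ‖inner ℂ (b i) x‖ ^ 2 := by
      intro i
      rw [← inner_conj_symm x (b i), mul_comm, Complex.mul_conj, Complex.normSq_eq_norm_sq]
      norm_cast
    simp only [e] at h3
    rw [inner_self_eq_norm_sq_to_K] at h3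
    convert h3 using 1
    norm_cast
  have h4 := h2.tsum_eq
  have key : ∀ r : ℝ, 0 ≤ r → ∀ z : ℝ≥0∞, z = ENNReal.ofReal r → z ^ 2 = ENNReal.ofReal (r ^ 2) := by
    intro r hr z hz
    rw [hz, ENNReal.ofReal_pow hr]
  rw [key ‖x‖ (norm_nonneg _) _ (ofReal_norm x).symm, ← h4,
    ENNReal.ofReal_tsum_of_nonneg (fun i => by positivity) h2.summable]
  exact tsum_congr fun i => key _ (norm_nonneg _) _ (ofReal_norm _).symm

/-- The sum `∑ ‖T eᵢ‖²` in `[0, ∞]` over an orthonormal basis `e`. -/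
def hsSq {ι : Type*} (b : HilbertBasis ι ℂ H) (T : H →L[ℂ] H) : ℝ≥0∞ :=
  ∑' i, ‖T (b i)‖ₑ ^ 2

theorem hsSq_adjoint {ι κ : Type*} (b : HilbertBasis ι ℂ H) (c : HilbertBasis κ ℂ H)
    (T : H →L[ℂ] H) : hsSq b T = hsSq c (star T) := by
  unfold hsSq
  calc ∑' i, ‖T (b i)‖ₑ ^ 2 = ∑' i, ∑' k, ‖inner ℂ (c k) (T (b i))‖ₑ ^ 2 :=
        tsum_congr fun i => (tsum_enorm_inner_sq c _).symm
    _ = ∑' k, ∑' i, ‖inner ℂ (c k) (T (b i))‖ₑ ^ 2 := ENNReal.tsum_comm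
    _ = ∑' k, ∑' i, ‖inner ℂ (b i) (star T (c k))‖ₑ ^ 2 := by
        refine tsum_congr fun k => tsum_congr fun i => ?_
        rw [ContinuousLinearMap.star_eq_adjoint, ContinuousLinearMap.adjoint_inner_right,
          ← inner_conj_symm, RCLike.enorm_conj]
    _ = ∑' k, ‖star T (c k)‖ₑ ^ 2 := tsum_congr fun k => tsum_enorm_inner_sq b _

/-- The sum `∑ ‖T eᵢ‖²` does not depend on the orthonormal basis. -/
theorem hsSq_indep {ι κ : Type*} (b : HilbertBasis ι ℂ H) (c : HilbertBasis κ ℂ H)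
    (T : H →L[ℂ] H) : hsSq b T = hsSq c T := by
  rw [hsSq_adjoint b c, hsSq_adjoint c c, star_star]

theorem hsSq_mul_left_le {ι : Type*} (b : HilbertBasis ι ℂ H) (S T : H →L[ℂ] H) :
    hsSq b (S * T) ≤ ‖S‖ₑ ^ 2 * hsSq b T := by
  unfold hsSq
  rw [← ENNReal.tsum_mul_left]
  refine ENNReal.tsum_le_tsum fun i => ?_
  rw [← mul_pow]
  gcongr
  exact S.le_opENorm (T (b i))

theorem hsSq_mul_le {ι : Type*} (b : HilbertBasis ι ℂ H) (S T R : H →L[ℂ] H) :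
    hsSq b (S * T * R) ≤ (‖S‖ₑ * ‖R‖ₑ) ^ 2 * hsSq b T := by
  have h1 : hsSq b (T * R) ≤ ‖R‖ₑ ^ 2 * hsSq b T := by
    rw [hsSq_adjoint b b (T * R), hsSq_adjoint b b T, star_mul]
    refine (hsSq_mul_left_le b _ _).trans_eq ?_
    rw [← ofReal_norm (star R), norm_star, ofReal_norm]
  rw [mul_assoc]
  refine (hsSq_mul_left_le b _ _).trans ?_
  rw [mul_pow, mul_assoc]
  gcongr

variable (H) in
/-- The index set of some orthonormal basis of `H`. -/
def basisIndex : Set H := (exists_hilbertBasis ℂ H).choose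

variable (H) in
/-- Some orthonormal basis of `H`. -/
def basis : HilbertBasis (basisIndex H) ℂ H := (exists_hilbertBasis ℂ H).choose_spec.choose

variable (H) in
/-- The space of Hilbert-Schmidt operators, `∑ ‖T eᵢ‖² < ∞`, as a subspace of `B(H)`.
It does not depend on the basis, see `mem_hsSubmodule_iff`. -/
def hsSubmodule : Submodule ℂ (H →L[ℂ] H) where
  carrier := {T | Memℓp (fun i => T (basis H i)) 2}
  zero_mem' := zero_memℓp
  add_mem' h1 h2 := h1.add h2
  smul_mem' c _ h := h.const_smul c

theorem mem_hsSubmodule_iff_summable (T : H →L[ℂ] H) :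
    T ∈ hsSubmodule H ↔ Summable fun i => ‖T (basis H i)‖ ^ 2 := by
  change Memℓp (fun i => T (basis H i)) 2 ↔ _
  rw [memℓp_gen_iff (by norm_num)]
  norm_num

theorem hsSq_eq_of_summable {ι : Type*} (b : HilbertBasis ι ℂ H) (T : H →L[ℂ] H)
    (h : Summable fun i => ‖T (b i)‖ ^ 2) :
    hsSq b T = ENNReal.ofReal (∑' i, ‖T (b i)‖ ^ 2) := by
  rw [ENNReal.ofReal_tsum_of_nonneg (fun i => by positivity) h]
  refine tsum_congr fun i => ?_
  rw [ENNReal.ofReal_pow (norm_nonneg _), ofReal_norm]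

theorem summable_iff_hsSq_lt_top {ι : Type*} (b : HilbertBasis ι ℂ H) (T : H →L[ℂ] H) :
    (Summable fun i => ‖T (b i)‖ ^ 2) ↔ hsSq b T < ∞ := by
  constructor
  · intro h
    rw [hsSq_eq_of_summable b T h]
    exact ENNReal.ofReal_lt_top
  · intro h
    have := ENNReal.summable_toReal h.ne
    simpa using this

/-- A bounded operator is Hilbert-Schmidt iff `∑ ‖T eᵢ‖² < ∞` for any orthonormal basis. -/
theorem mem_hsSubmodule_iff {ι : Type*} (b : HilbertBasis ι ℂ H) (T : H →L[ℂ] H) :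
    T ∈ hsSubmodule H ↔ Summable fun i => ‖T (b i)‖ ^ 2 := by
  rw [mem_hsSubmodule_iff_summable, summable_iff_hsSq_lt_top, summable_iff_hsSq_lt_top,
    hsSq_indep b (basis H)]

variable (H) in
/-- The ideal `C₂` of Hilbert-Schmidt operators on `H`, which below carries the Hilbert-Schmidt
norm (and not the operator norm). -/
def HilbertSchmidt : Type _ := hsSubmodule H

namespace HilbertSchmidt

instance : AddCommGroup (HilbertSchmidt H) := inferInstanceAs (AddCommGroup (hsSubmodule H))

instance : Module ℂ (HilbertSchmidt H) := inferInstanceAs (Module ℂ (hsSubmodule H))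

variable (H) in
/-- The inclusion of the Hilbert-Schmidt operators in `B(H)`. -/
def incl : HilbertSchmidt H →ₗ[ℂ] (H →L[ℂ] H) := (hsSubmodule H).subtype

theorem incl_mem (T : HilbertSchmidt H) : incl H T ∈ hsSubmodule H := T.2

theorem incl_injective : Function.Injective (incl H) := Subtype.val_injective

/-- A bounded operator with `∑ ‖T eᵢ‖² < ∞` as an element of `C₂`. -/
def ofMem (T : H →L[ℂ] H) (h : T ∈ hsSubmodule H) : HilbertSchmidt H := ⟨T, h⟩

theorem incl_ofMem (T : H →L[ℂ] H) (h : T ∈ hsSubmodule H) : incl H (ofMem T h) = T := rfl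

variable (H) in
/-- The linear map `T ↦ (T eᵢ)ᵢ` from the Hilbert-Schmidt operators to `ℓ²(H)`. -/
def toLp : HilbertSchmidt H →ₗ[ℂ] lp (fun _ : basisIndex H => H) 2 where
  toFun T := ⟨fun i => incl H T (basis H i), incl_mem T⟩
  map_add' _ _ := rfl
  map_smul' _ _ := rfl

theorem toLp_injective : Function.Injective (toLp H) := by
  intro S T h
  apply incl_injective
  refine ContinuousLinearMap.ext_on (s := Set.range (basis H)) ?_ ?_
  · rw [dense_iff_closure_eq]
    have := (basis H).dense_span
    rw [Submodule.eq_top_iff'] at this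
    exact Set.eq_univ_of_forall this
  · rintro _ ⟨i, rfl⟩
    exact congrFun (congrArg Subtype.val h) i

/-- The Hilbert-Schmidt norm `‖T‖₂ = (∑ ‖T eᵢ‖²)^(1/2)`, see `norm_sq_eq`. -/
instance : NormedAddCommGroup (HilbertSchmidt H) :=
  NormedAddCommGroup.induced _ _ (toLp H) toLp_injective

/-- The inner product `⟪S, T⟫ = ∑ ⟪S eᵢ, T eᵢ⟫`. -/
instance : InnerProductSpace ℂ (HilbertSchmidt H) := InnerProductSpace.induced (toLp H)

/-- `‖T‖₂² = ∑ ‖T eᵢ‖²` for every orthonormal basis. -/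
theorem norm_sq_eq {ι : Type*} (b : HilbertBasis ι ℂ H) (T : HilbertSchmidt H) :
    ‖T‖ ^ 2 = ∑' i, ‖incl H T (b i)‖ ^ 2 := by
  have h1 : ‖T‖ ^ 2 = ∑' i, ‖incl H T (basis H i)‖ ^ 2 := by
    have := lp.norm_rpow_eq_tsum (p := 2) (by norm_num) (toLp H T)
    norm_num at this
    exact this
  have h2 := hsSq_indep b (basis H) (incl H T)
  rw [hsSq_eq_of_summable b _ ((mem_hsSubmodule_iff b _).1 (incl_mem T)),
    hsSq_eq_of_summable _ _ ((mem_hsSubmodule_iff (basis H) _).1 (incl_mem T)),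
    ENNReal.ofReal_eq_ofReal_iff (tsum_nonneg fun _ => by positivity)
      (tsum_nonneg fun _ => by positivity)] at h2
  rw [h1, h2]

theorem ofReal_norm_sq (T : HilbertSchmidt H) :
    ENNReal.ofReal (‖T‖ ^ 2) = hsSq (basis H) (incl H T) := by
  rw [norm_sq_eq (basis H), hsSq_eq_of_summable _ _ ((mem_hsSubmodule_iff (basis H) _).1 (incl_mem T))]

theorem toLp_surjective : Function.Surjective (toLp H) := by
  intro v
  have hv : Summable fun i => ‖v i‖ ^ 2 := by
    have := (lp.memℓp v).summable (by norm_num)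
    norm_num at this
    exact this
  have hvn : ∑' i, ‖v i‖ ^ 2 = ‖v‖ ^ 2 := by
    have := lp.norm_rpow_eq_tsum (p := 2) (by norm_num) v
    norm_num at this
    exact this.symm
  have hx : ∀ x : H, HasSum (fun i => ‖(basis H).repr x i‖ ^ 2) (‖x‖ ^ 2) := by
    intro x
    have := lp.hasSum_norm (p := 2) (by norm_num) ((basis H).repr x)
    norm_num at this
    exact this
  have hs : ∀ x : H, Summable fun i => (basis H).repr x i • v i := by
    intro x
    refine Summable.of_norm_bounded ((hx x).summable.add hv) fun i => ?_
    rw [norm_smul]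
    nlinarith [sq_nonneg (‖(basis H).repr x i‖ - ‖v i‖), sq_nonneg ‖(basis H).repr x i‖,
      sq_nonneg ‖v i‖]
  let T : H →L[ℂ] H := LinearMap.mkContinuous
    { toFun := fun x => ∑' i, (basis H).repr x i • v i
      map_add' := fun x y => by
        rw [← (hs x).tsum_add (hs y)]
        exact tsum_congr fun i => by rw [map_add, lp.coeFn_add, Pi.add_apply, add_smul]
      map_smul' := fun c x => by
        rw [RingHom.id_apply, ← (hs x).tsum_const_smul]
        exact tsum_congr fun i => by
          rw [map_smul, lp.coeFn_smul, Pi.smul_apply, smul_assoc] }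
    ‖v‖ fun x => by
      obtain ⟨C, -, hC, hCs⟩ := Real.inner_le_Lp_mul_Lq_hasSum_of_nonneg
        Real.HolderConjugate.two_two (norm_nonneg x) (norm_nonneg v)
        (f := fun i => ‖(basis H).repr x i‖) (g := fun i => ‖v i‖)
        (fun _ => norm_nonneg _) (fun _ => norm_nonneg _)
        (by norm_num; exact hx x) (by norm_num; exact hvn ▸ hv.hasSum)
      refine (tsum_of_norm_bounded hCs fun i => (norm_smul_le _ _)).trans ?_
      rwa [mul_comm]
  have hT : ∀ i, T (basis H i) = v i := by
    intro i
    change ∑' k, (basis H).repr (basis H i) k • v k = v i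
    classical
    rw [HilbertBasis.repr_self, tsum_eq_single i]
    · simp
    · intro k hk
      simp [hk]
  refine ⟨ofMem T ?_, ?_⟩
  · rw [mem_hsSubmodule_iff_summable]
    simpa only [hT] using hv
  · ext i
    exact hT i

/-- `C₂` is a Hilbert space. -/
instance : CompleteSpace (HilbertSchmidt H) :=
  (LinearIsometryEquiv.ofSurjective (⟨toLp H, fun _ => rfl⟩ : HilbertSchmidt H →ₗᵢ[ℂ] _)
    toLp_surjective).toIsometryEquiv.completeSpace

end HilbertSchmidt

/-! ### Multiplication operators -/

variable {J : Type*}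

theorem summable_norm_mul_norm {A B : J → H →L[ℂ] H}
    (hA : Summable fun j => ‖A j‖ ^ 2) (hB : Summable fun j => ‖B j‖ ^ 2) :
    Summable fun j => ‖A j‖ * ‖B j‖ := by
  refine Summable.of_nonneg_of_le (fun j => by positivity) (fun j => ?_) (hA.add hB)
  nlinarith [sq_nonneg (‖A j‖ - ‖B j‖), sq_nonneg (‖A j‖ + ‖B j‖)]

theorem norm_mul_mul_le (S X T : H →L[ℂ] H) : ‖S * X * T‖ ≤ ‖S‖ * ‖T‖ * ‖X‖ :=
  (norm_mul_le _ _).trans <| by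
    calc ‖S * X‖ * ‖T‖ ≤ ‖S‖ * ‖X‖ * ‖T‖ := by gcongr; exact norm_mul_le _ _
      _ = _ := by ring

/-- The series `∑ A_j X B_j` converges in norm. -/
theorem summable_mul_mul {A B : J → H →L[ℂ] H}
    (hA : Summable fun j => ‖A j‖ ^ 2) (hB : Summable fun j => ‖B j‖ ^ 2) (X : H →L[ℂ] H) :
    Summable fun j => A j * X * B j :=
  Summable.of_norm_bounded ((summable_norm_mul_norm hA hB).mul_right ‖X‖)
    fun _ => norm_mul_mul_le _ _ _

/-- The multiplication operator `Δ(X) = ∑ A_j X B_j` on `B(H)`. -/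
def multOp (A B : J → H →L[ℂ] H)
    (hA : Summable fun j => ‖A j‖ ^ 2) (hB : Summable fun j => ‖B j‖ ^ 2) :
    (H →L[ℂ] H) →L[ℂ] (H →L[ℂ] H) :=
  LinearMap.mkContinuous
    { toFun := fun X => ∑' j, A j * X * B j
      map_add' := fun X Y => by
        rw [← (summable_mul_mul hA hB X).tsum_add (summable_mul_mul hA hB Y)]
        exact tsum_congr fun j => by rw [mul_add, add_mul]
      map_smul' := fun c X => by
        rw [RingHom.id_apply, ← (summable_mul_mul hA hB X).tsum_const_smul]
        exact tsum_congr fun j => by rw [mul_smul_comm, smul_mul_assoc] }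
    (∑' j, ‖A j‖ * ‖B j‖) fun X => by
      refine tsum_of_norm_bounded
        ((summable_norm_mul_norm hA hB).hasSum.mul_right ‖X‖) fun j => norm_mul_mul_le _ _ _

theorem hasSum_multOp (A B : J → H →L[ℂ] H)
    (hA : Summable fun j => ‖A j‖ ^ 2) (hB : Summable fun j => ‖B j‖ ^ 2) (X : H →L[ℂ] H) :
    HasSum (fun j => A j * X * B j) (multOp A B hA hB X) :=
  (summable_mul_mul hA hB X).hasSum

theorem hs_mul_mul_mem (S R : H →L[ℂ] H) (T : HilbertSchmidt H) :
    S * HilbertSchmidt.incl H T * R ∈ hsSubmodule H := by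
  rw [mem_hsSubmodule_iff (basis H), summable_iff_hsSq_lt_top]
  refine (hsSq_mul_le _ _ _ _).trans_lt (ENNReal.mul_lt_top ?_ ?_)
  · exact ENNReal.pow_lt_top (ENNReal.mul_lt_top enorm_lt_top enorm_lt_top)
  · exact (summable_iff_hsSq_lt_top _ _).1
      ((mem_hsSubmodule_iff (basis H) _).1 (HilbertSchmidt.incl_mem T))

/-- The operator `T ↦ S T R` on Hilbert-Schmidt operators. -/
def hsMulMul (S R : H →L[ℂ] H) (T : HilbertSchmidt H) : HilbertSchmidt H :=
  HilbertSchmidt.ofMem (S * HilbertSchmidt.incl H T * R) (hs_mul_mul_mem S R T)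

theorem norm_hsMulMul_le (S R : H →L[ℂ] H) (T : HilbertSchmidt H) :
    ‖hsMulMul S R T‖ ≤ ‖S‖ * ‖R‖ * ‖T‖ := by
  refine abs_le_of_sq_le_sq' ?_ (by positivity) |>.2
  have h := hsSq_mul_le (basis H) S (HilbertSchmidt.incl H T) R
  have h2 := HilbertSchmidt.ofReal_norm_sq (hsMulMul S R T)
  rw [hsMulMul, HilbertSchmidt.incl_ofMem] at h2
  rw [← HilbertSchmidt.ofReal_norm_sq T, ← h2,
    ← ofReal_norm, ← ofReal_norm, ← ENNReal.ofReal_mul (norm_nonneg _),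
    ← ENNReal.ofReal_pow (by positivity), ← ENNReal.ofReal_mul (by positivity),
    ENNReal.ofReal_le_ofReal_iff (by positivity)] at h
  rwa [mul_pow]

/-- `∑ ‖Δ(T) eᵢ‖² ≤ (∑ ‖A_j‖ ‖B_j‖)² ‖T‖₂²`, for finitely many `i`. -/
theorem sum_norm_multOp_sq_le (A B : J → H →L[ℂ] H)
    (hA : Summable fun j => ‖A j‖ ^ 2) (hB : Summable fun j => ‖B j‖ ^ 2)
    (T : HilbertSchmidt H) (s : Finset (basisIndex H)) :
    ∑ i ∈ s, ‖multOp A B hA hB (HilbertSchmidt.incl H T) (basis H i)‖ ^ 2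
      ≤ ((∑' j, ‖A j‖ * ‖B j‖) * ‖T‖) ^ 2 := by
  have hS := hasSum_multOp A B hA hB (HilbertSchmidt.incl H T)
  have hlim : Filter.Tendsto
      (fun u : Finset J => ∑ i ∈ s,
        ‖(∑ j ∈ u, A j * HilbertSchmidt.incl H T * B j) (basis H i)‖ ^ 2) Filter.atTop
      (nhds (∑ i ∈ s,
        ‖multOp A B hA hB (HilbertSchmidt.incl H T) (basis H i)‖ ^ 2)) := by
    refine tendsto_finsetSum _ fun i _ => ?_
    exact (((ContinuousLinearMap.apply ℂ H (basis H i)).continuous.tendsto _).comp hS).norm.pow 2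
  refine le_of_tendsto' hlim fun u => ?_
  have h1 : HilbertSchmidt.incl H (∑ j ∈ u, hsMulMul (A j) (B j) T)
      = ∑ j ∈ u, A j * HilbertSchmidt.incl H T * B j := map_sum _ _ _
  rw [← h1]
  set V := ∑ j ∈ u, hsMulMul (A j) (B j) T
  calc _ ≤ ∑' i, ‖HilbertSchmidt.incl H V (basis H i)‖ ^ 2 :=
        ((mem_hsSubmodule_iff (basis H) _).1 (HilbertSchmidt.incl_mem V)).sum_le_tsum _ fun _ _ => by positivity
    _ = ‖V‖ ^ 2 := (HilbertSchmidt.norm_sq_eq _ _).symm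
    _ ≤ _ := by
      gcongr
      refine (norm_sum_le _ _).trans ?_
      refine (Finset.sum_le_sum fun j _ => norm_hsMulMul_le (A j) (B j) T).trans ?_
      rw [← Finset.sum_mul]
      gcongr
      exact (summable_norm_mul_norm hA hB).sum_le_tsum _ fun _ _ => by positivity

/-- `Δ` preserves the Hilbert-Schmidt operators. -/
theorem multOp_mem (A B : J → H →L[ℂ] H)
    (hA : Summable fun j => ‖A j‖ ^ 2) (hB : Summable fun j => ‖B j‖ ^ 2)
    (T : HilbertSchmidt H) :
    multOp A B hA hB (HilbertSchmidt.incl H T) ∈ hsSubmodule H := by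
  rw [mem_hsSubmodule_iff (basis H)]
  exact summable_of_sum_le (fun _ => by positivity) (sum_norm_multOp_sq_le A B hA hB T)

/-- The restriction of `Δ` to the Hilbert-Schmidt operators, a bounded operator for the
Hilbert-Schmidt norm. -/
def multOpHS (A B : J → H →L[ℂ] H)
    (hA : Summable fun j => ‖A j‖ ^ 2) (hB : Summable fun j => ‖B j‖ ^ 2) :
    HilbertSchmidt H →L[ℂ] HilbertSchmidt H :=
  LinearMap.mkContinuous
    { toFun := fun T => HilbertSchmidt.ofMem (multOp A B hA hB (HilbertSchmidt.incl H T))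
        (multOp_mem A B hA hB T)
      map_add' := fun S T => HilbertSchmidt.incl_injective (by
        simp only [map_add, HilbertSchmidt.incl_ofMem])
      map_smul' := fun c T => HilbertSchmidt.incl_injective (by
        simp only [map_smul, HilbertSchmidt.incl_ofMem, RingHom.id_apply]) }
    (∑' j, ‖A j‖ * ‖B j‖) fun T => by
      refine abs_le_of_sq_le_sq' ?_
        (mul_nonneg (tsum_nonneg fun _ => by positivity) (norm_nonneg _)) |>.2
      rw [HilbertSchmidt.norm_sq_eq (basis H)]
      exact Real.tsum_le_of_sum_le (fun _ => by positivity) (sum_norm_multOp_sq_le A B hA hB T)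

theorem incl_multOpHS (A B : J → H →L[ℂ] H)
    (hA : Summable fun j => ‖A j‖ ^ 2) (hB : Summable fun j => ‖B j‖ ^ 2)
    (T : HilbertSchmidt H) :
    HilbertSchmidt.incl H (multOpHS A B hA hB T)
      = multOp A B hA hB (HilbertSchmidt.incl H T) := rfl

/-! ### The joint spectrum -/

/-- The unital C*-algebra generated by a family of operators. -/
def cstarGen (A : J → H →L[ℂ] H) : StarSubalgebra ℂ (H →L[ℂ] H) :=
  (StarAlgebra.adjoin ℂ (Set.range A)).topologicalClosure

theorem mem_cstarGen (A : J → H →L[ℂ] H) (j : J) : A j ∈ cstarGen A :=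
  StarSubalgebra.le_topologicalClosure _ (StarAlgebra.subset_adjoin ℂ _ ⟨j, rfl⟩)

/-- The joint spectrum of a commutative family of normal operators: the image of the Gelfand
spectrum of the (commutative) unital C*-algebra that the family generates under
`χ ↦ (χ(A_j))_j`. -/
def jointSpectrum (A : J → H →L[ℂ] H) : Set (J → ℂ) :=
  Set.range fun (χ : WeakDual.characterSpace ℂ (cstarGen A)) (j : J) =>
    χ ⟨A j, mem_cstarGen A j⟩

theorem norm_le_of_mem_jointSpectrum {A : J → H →L[ℂ] H} {l : J → ℂ}
    (hl : l ∈ jointSpectrum A) (j : J) : ‖l j‖ ≤ ‖A j‖ := by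
  obtain ⟨χ, rfl⟩ := hl
  have : CompleteSpace (cstarGen A) :=
    (StarSubalgebra.isClosed_topologicalClosure _).completeSpace_coe
  refine (spectrum.norm_le_norm_mul_of_mem (AlgHom.apply_mem_spectrum χ _)).trans ?_
  have h1 : ‖(1 : cstarGen A)‖ ≤ 1 := ContinuousLinearMap.norm_id_le
  exact (mul_le_of_le_one_right (norm_nonneg _) h1)

/-- The series `l · m = ∑ l_j m_j` converges for `l`, `m` in the joint spectra. -/
theorem summable_mul_of_mem_jointSpectrum {A B : J → H →L[ℂ] H}
    (hA : Summable fun j => ‖A j‖ ^ 2) (hB : Summable fun j => ‖B j‖ ^ 2) {l m : J → ℂ}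
    (hl : l ∈ jointSpectrum A) (hm : m ∈ jointSpectrum B) : Summable fun j => l j * m j := by
  refine Summable.of_norm_bounded (summable_norm_mul_norm hA hB) fun j => ?_
  rw [norm_mul]
  gcongr
  · exact norm_le_of_mem_jointSpectrum hl j
  · exact norm_le_of_mem_jointSpectrum hm j

end MultiplicationOperators

end

namespace MultiplicationOperators

/-! ### Commutative subalgebras and characters -/

/-! Both spectra are computed by the same two abstract arguments, applied once to `B(H)` and once to
`C₂`.

Upper bound (`exists_jointSpectrum_of_mem_spectrum`): by Fuglede, `cstarGen A` and `cstarGen B` are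
commutative, and left multiplications commute with right ones. Hence all multiplications by their
elements lie in one closed commutative algebra, which also contains `Δ = ∑ L(A_j) R(B_j)`. By
Gelfand theory a spectral value of `Δ` is `φ(Δ)` for a character `φ`; composing `φ` with `L` and `R`
gives characters of the two C*-algebras, that is, points `l` and `m` of the joint spectra, and
continuity of `φ` gives `φ(Δ) = ∑ l_j m_j`.

Lower bound (`mem_spectrum_of_jointSpectrum`): points of the joint spectra have joint approximate
eigenvectors `xₙ`, `yₙ` (`exists_approx_joint_eigenvector`). Since the `B_j` are normal, `yₙ` also
serves the adjoints, so the rank one operators `z ↦ ⟪yₙ, z⟫ xₙ` are approximate eigenvectors of `Δ`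
at `∑ l_j m_j`. They have norm one in both the operator and the Hilbert-Schmidt norm. -/

/-- The double centralizer works: since `s` lies in its own centralizer, `s''` lies in `s'`, and
every element of `s''` commutes with `s'`. -/
theorem exists_closed_commutative_subalgebra {E : Type*} [NormedRing E] [NormedAlgebra ℂ E]
    {s : Set E} (hs : ∀ a ∈ s, ∀ b ∈ s, a * b = b * a) :
    ∃ S : Subalgebra ℂ E, IsClosed (S : Set E) ∧ s ⊆ S ∧ ∀ x ∈ S, ∀ y ∈ S, x * y = y * x := by
  refine ⟨Subalgebra.centralizer ℂ (s.centralizer), Set.isClosed_centralizer _,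
    Set.subset_centralizer_centralizer, fun x hx y hy => ?_⟩
  have hsub : s ⊆ s.centralizer := fun a ha b hb => hs b hb a ha
  exact hy x (Set.centralizer_subset hsub hx)

theorem exists_character_of_mem_spectrum {E : Type*} [NormedRing E] [NormedAlgebra ℂ E]
    [CompleteSpace E] (S : Subalgebra ℂ E) (hS : IsClosed (S : Set E))
    (hc : ∀ x ∈ S, ∀ y ∈ S, x * y = y * x) (D : S) {z : ℂ}
    (hz : z ∈ spectrum ℂ (D : E)) : ∃ φ : S →ₐ[ℂ] ℂ, Continuous φ ∧ φ D = z := by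
  let _ : NormedCommRing S :=
    { (inferInstance : NormedRing S) with
      mul_comm := fun x y => Subtype.ext (hc x x.2 y y.2) }
  have : CompleteSpace S := hS.completeSpace_coe
  -- Passing to a subalgebra can only enlarge the spectrum, which is the direction needed here.
  have h1 : z ∈ spectrum ℂ D := AlgHom.spectrum_apply_subset S.val D hz
  obtain ⟨f, hf⟩ := WeakDual.CharacterSpace.mem_spectrum_iff_exists.1 h1
  exact ⟨WeakDual.CharacterSpace.toAlgHom f, map_continuous f, hf⟩

variable {H : Type*} [NormedAddCommGroup H] [InnerProductSpace ℂ H] [CompleteSpace H]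
variable {J : Type*}

/-- Fuglede's theorem puts the family in the centralizer of itself and its adjoints; the double
centralizer is then commutative, and it is closed, so it contains `cstarGen A`. -/
theorem cstarGen_commute {A : J → H →L[ℂ] H} (hAn : ∀ j, IsStarNormal (A j))
    (hAc : ∀ i j, Commute (A i) (A j)) {x y : H →L[ℂ] H} (hx : x ∈ cstarGen A)
    (hy : y ∈ cstarGen A) : x * y = y * x := by
  have hle := StarAlgebra.adjoin_le_centralizer_centralizer ℂ (Set.range A)
  have hcl : cstarGen A ≤ StarSubalgebra.centralizer ℂ
      (StarSubalgebra.centralizer ℂ (Set.range A) : Set (H →L[ℂ] H)) :=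
    StarSubalgebra.topologicalClosure_minimal hle (Set.isClosed_centralizer _)
  have hsub : Set.range A ⊆ StarSubalgebra.centralizer ℂ (Set.range A) := by
    rintro _ ⟨j, rfl⟩
    refine StarSubalgebra.mem_centralizer_iff ℂ |>.2 ?_
    rintro _ ⟨i, rfl⟩
    exact ⟨hAc i j, (hAn i).commute_star_left (hAc i j)⟩
  have hy' := StarSubalgebra.mem_centralizer_iff ℂ |>.1 (hcl hy)
  have hx' := StarSubalgebra.mem_centralizer_iff ℂ |>.1 (hcl hx)
  refine (hy' x ?_).1
  refine StarSubalgebra.mem_centralizer_iff ℂ |>.2 fun g hg => ?_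
  have h := hx' g (hsub hg)
  exact h

instance (A : J → H →L[ℂ] H) : CompleteSpace (cstarGen A) :=
  (StarSubalgebra.isClosed_topologicalClosure _).completeSpace_coe

/-- A character that is multiplicative on the C*-algebra generated by `A` defines a point of the
joint spectrum. -/
theorem exists_mem_jointSpectrum_of_algHom {A : J → H →L[ℂ] H} {E : Type*} [Ring E] [Algebra ℂ E]
    (T : (H →L[ℂ] H) →ₗ[ℂ] E) (hT1 : T 1 = 1)
    (hTm : ∀ a ∈ cstarGen A, ∀ b ∈ cstarGen A, T (a * b) = T a * T b)
    (S : Subalgebra ℂ E) (hTS : ∀ a ∈ cstarGen A, T a ∈ S) (φ : S →ₐ[ℂ] ℂ) :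
    ∃ l ∈ jointSpectrum A, ∀ j, φ ⟨T (A j), hTS _ (mem_cstarGen A j)⟩ = l j := by
  let ψ : cstarGen A →ₐ[ℂ] ℂ := AlgHom.ofLinearMap
    { toFun := fun a => φ ⟨T a, hTS a a.2⟩
      map_add' := fun a b => by
        rw [← map_add]
        congr 1
        exact Subtype.ext (map_add T (a : H →L[ℂ] H) b)
      map_smul' := fun c a => by
        rw [RingHom.id_apply, ← map_smul]
        congr 1
        exact Subtype.ext (map_smul T c (a : H →L[ℂ] H)) }
    ((congrArg φ (Subtype.ext hT1)).trans (map_one φ))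
    (fun a b => (congrArg φ (Subtype.ext (hTm a a.2 b b.2))).trans (map_mul φ _ _))
  exact ⟨_, ⟨WeakDual.CharacterSpace.equivAlgHom.symm ψ, rfl⟩, fun j => rfl⟩

/-- `E` stands for the bounded operators on `B(H)` or on `C₂`, with `L` and `R` the left and right
multiplications. -/
theorem exists_jointSpectrum_of_mem_spectrum {A B : J → H →L[ℂ] H}
    (hAn : ∀ j, IsStarNormal (A j)) (hBn : ∀ j, IsStarNormal (B j))
    (hAc : ∀ i j, Commute (A i) (A j)) (hBc : ∀ i j, Commute (B i) (B j))
    {E : Type*} [NormedRing E] [NormedAlgebra ℂ E] [CompleteSpace E]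
    (L R : (H →L[ℂ] H) →ₗ[ℂ] E) (hL1 : L 1 = 1) (hR1 : R 1 = 1)
    (hL : ∀ a b, L (a * b) = L a * L b) (hR : ∀ a b, R (a * b) = R b * R a)
    (hLR : ∀ a b, L a * R b = R b * L a) {D : E}
    (hD : HasSum (fun j => L (A j) * R (B j)) D) {z : ℂ} (hz : z ∈ spectrum ℂ D) :
    ∃ l ∈ jointSpectrum A, ∃ m ∈ jointSpectrum B, z = ∑' j, l j * m j := by
  have hAcomm {x y} := cstarGen_commute (x := x) (y := y) hAn hAc
  have hBcomm {x y} := cstarGen_commute (x := x) (y := y) hBn hBc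
  obtain ⟨S, hS, hsub, hc⟩ := exists_closed_commutative_subalgebra
    (s := L '' cstarGen A ∪ R '' cstarGen B) (by
      rintro _ (⟨a, ha, rfl⟩ | ⟨a, ha, rfl⟩) _ (⟨b, hb, rfl⟩ | ⟨b, hb, rfl⟩)
      · rw [← hL, hAcomm ha hb, hL]
      · exact hLR a b
      · exact (hLR b a).symm
      · rw [← hR, hBcomm hb ha, hR])
  have hLS : ∀ a ∈ cstarGen A, L a ∈ S := fun a ha => hsub (Or.inl ⟨a, ha, rfl⟩)
  have hRS : ∀ b ∈ cstarGen B, R b ∈ S := fun b hb => hsub (Or.inr ⟨b, hb, rfl⟩)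
  have hterm : ∀ j, L (A j) * R (B j) ∈ S := fun j =>
    S.mul_mem (hLS _ (mem_cstarGen A j)) (hRS _ (mem_cstarGen B j))
  have hDS : D ∈ S := hS.mem_of_tendsto hD (Filter.Eventually.of_forall fun u =>
    S.sum_mem fun j _ => hterm j)
  -- The sum is moved into `S`, where the continuous character `φ` can be applied term by term.
  have hD' : HasSum (fun j => (⟨L (A j) * R (B j), hterm j⟩ : S)) ⟨D, hDS⟩ :=
    (Topology.IsInducing.subtypeVal.hasSum_iff (g := S.val.toLinearMap.toAddMonoidHom) _ _).1 hD
  obtain ⟨φ, hφ, rfl⟩ := exists_character_of_mem_spectrum S hS hc ⟨D, hDS⟩ hz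
  obtain ⟨l, hl, hlj⟩ := exists_mem_jointSpectrum_of_algHom L hL1 (fun a _ b _ => hL a b) S hLS φ
  -- `R` reverses products, so its multiplicativity is available only on the commutative algebra
  -- `cstarGen B`.
  obtain ⟨m, hm, hmj⟩ := exists_mem_jointSpectrum_of_algHom R hR1
    (fun a ha b hb => by rw [hBcomm ha hb, hR]) S hRS φ
  refine ⟨l, hl, m, hm, ((hD'.map φ hφ).tsum_eq.symm.trans (tsum_congr fun j => ?_))⟩
  rw [← hlj, ← hmj, ← map_mul]
  rfl

/-! ### Approximate joint eigenvectors -/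

/-- The single operator `c = ∑ (A_j - l_j)* (A_j - l_j)` controls all coordinates: `⟪c x, x⟫ = ∑
‖A_j x - l_j x‖²`. The character defining `l` kills `c`, so `c` is not invertible and this form
cannot be bounded below on unit vectors. -/
theorem exists_approx_joint_eigenvector {A : J → H →L[ℂ] H} (hA : Summable fun j => ‖A j‖ ^ 2)
    {l : J → ℂ} (hl : l ∈ jointSpectrum A) :
    ∃ x : ℕ → H, (∀ n, ‖x n‖ = 1) ∧
      ∀ j, Filter.Tendsto (fun n => A j (x n) - l j • x n) Filter.atTop (nhds 0) := by
  have hlA := norm_le_of_mem_jointSpectrum hl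
  obtain ⟨χ, rfl⟩ := hl
  set l : J → ℂ := fun j => χ ⟨A j, mem_cstarGen A j⟩
  let d : J → cstarGen A := fun j => ⟨A j, mem_cstarGen A j⟩ - algebraMap ℂ _ (l j)
  have hχd : ∀ j, χ (d j) = 0 := fun j => by
    simp only [d, map_sub, AlgHomClass.commutes]
    exact sub_self _
  have hdx : ∀ j (x : H), (d j : H →L[ℂ] H) x = A j x - l j • x := fun j x => rfl
  have hdn : ∀ j, ‖d j‖ ≤ 2 * ‖A j‖ := fun j => by
    refine ContinuousLinearMap.opNorm_le_bound _ (by positivity) fun x => ?_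
    change ‖A j x - l j • x‖ ≤ _
    refine (norm_sub_le _ _).trans ?_
    rw [norm_smul]
    nlinarith [(A j).le_opNorm x, mul_le_mul_of_nonneg_right (hlA j) (norm_nonneg x)]
  have hsum : Summable fun j => star (d j) * d j := by
    refine Summable.of_norm_bounded (hA.mul_left 4) fun j => ?_
    refine (norm_mul_le _ _).trans ?_
    rw [norm_star]
    nlinarith [hdn j, norm_nonneg (d j), norm_nonneg (A j)]
  set c : cstarGen A := ∑' j, star (d j) * d j
  have hχc : χ c = 0 := by
    refine (hsum.hasSum.map χ (map_continuous χ)).unique ?_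
    convert hasSum_zero with j
    simp [hχd]
  -- Spectral permanence: an element of a closed star subalgebra that is invertible in `B(H)` is
  -- already invertible in the subalgebra.
  have hc : ¬ IsUnit (c : H →L[ℂ] H) := by
    have : IsClosed (cstarGen A : Set (H →L[ℂ] H)) :=
      StarSubalgebra.isClosed_topologicalClosure _
    rw [StarSubalgebra.coe_isUnit]
    intro h
    exact (h.map χ).ne_zero hχc
  have hcx : ∀ x, HasSum (fun j => ‖A j x - l j • x‖ ^ 2) (inner ℂ ((c : H →L[ℂ] H) x) x).re := by
    intro x
    have h1 : HasSum (fun j => ((star (d j) * d j : cstarGen A) : H →L[ℂ] H)) c :=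
      hsum.hasSum.map (cstarGen A).subtype continuous_subtype_val
    have h2 := Complex.hasSum_re
      ((h1.mapL (ContinuousLinearMap.apply ℂ H x)).mapL ((innerSL ℂ x)))
    have h3 : ∀ y : H, (inner ℂ y x).re = (innerSL ℂ x y).re := fun y => by
      rw [innerSL_apply_apply]
      exact inner_re_symm (𝕜 := ℂ) _ _
    rw [h3]
    refine (congrArg (fun g => HasSum g _) (funext fun j => ?_)).mpr h2
    change _ = (inner ℂ x ((star (d j : H →L[ℂ] H)) ((d j : H →L[ℂ] H) x))).re
    rw [ContinuousLinearMap.star_eq_adjoint, ContinuousLinearMap.adjoint_inner_right, hdx]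
    exact (inner_self_eq_norm_sq (𝕜 := ℂ) _).symm
  have key : ∀ n : ℕ, ∃ x : H, ‖x‖ = 1 ∧ ∀ j, ‖A j x - l j • x‖ ^ 2 ≤ 1 / ((n : ℝ) + 1) := by
    intro n
    by_contra! hcon
    -- Lax-Milgram: if every unit vector had one term above `1 / (n + 1)`, the whole form would be
    -- coercive with this constant.
    refine hc (ContinuousLinearMap.isUnit_of_forall_le_norm_inner_map _
      (c := 1 / ((n : NNReal) + 1)) (by positivity) fun x => ?_)
    by_cases hx : x = 0
    · simp [hx]
    have hx' : 0 < ‖x‖ := norm_pos_iff.2 hx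
    obtain ⟨j, hj⟩ := hcon ((‖x‖⁻¹ : ℂ) • x) (by
      rw [norm_smul, norm_inv, Complex.norm_real, norm_norm, inv_mul_cancel₀ hx'.ne'])
    rw [map_smul, smul_comm, ← smul_sub, norm_smul, norm_inv, Complex.norm_real, norm_norm,
      mul_pow, inv_pow, inv_mul_eq_div, lt_div_iff₀ (by positivity)] at hj
    have h1 := le_hasSum (hcx x) j fun i _ => by positivity
    have h2 := Complex.abs_re_le_norm (inner ℂ ((c : H →L[ℂ] H) x) x)
    have h3 := le_abs_self (inner ℂ ((c : H →L[ℂ] H) x) x).re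
    push_cast
    linarith
  choose x hx1 hx using key
  refine ⟨x, hx1, fun j => ?_⟩
  have h0 : Filter.Tendsto (fun n => ‖A j (x n) - l j • x n‖ ^ 2) Filter.atTop (nhds 0) :=
    squeeze_zero (fun _ => by positivity) (fun n => hx n j) tendsto_one_div_add_atTop_nhds_zero_nat
  rw [tendsto_zero_iff_norm_tendsto_zero]
  have := h0.sqrt
  simpa [Real.sqrt_sq] using this

/-- `T - m` is again normal, and a normal operator and its adjoint have equal norms on each vector.
This turns approximate eigenvectors of `B_j` into those of its adjoint. -/
theorem norm_adjoint_sub_smul {T : H →L[ℂ] H} (hT : IsStarNormal T) (m : ℂ) (y : H) :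
    ‖star T y - (starRingEnd ℂ) m • y‖ = ‖T y - m • y‖ := by
  have h : IsStarNormal (T - algebraMap ℂ _ m) := by
    refine ⟨?_⟩
    rw [star_sub, ← algebraMap_star_comm]
    have h1 := hT.star_comm_self
    exact ((h1.sub_right (Algebra.commutes m (star T)).symm).sub_left
      (Algebra.commutes _ _))
  have h2 := (ContinuousLinearMap.isStarNormal_iff_norm_eq_adjoint.1 h y).symm
  rw [← ContinuousLinearMap.star_eq_adjoint, star_sub, ← algebraMap_star_comm] at h2
  exact h2

/-- If `ρ x y` behaves like a rank one operator, then `D` has approximate eigenvectors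
`ρ xₙ yₙ`. -/
theorem mem_spectrum_of_jointSpectrum {A B : J → H →L[ℂ] H}
    (hBn : ∀ j, IsStarNormal (B j))
    (hA : Summable fun j => ‖A j‖ ^ 2) (hB : Summable fun j => ‖B j‖ ^ 2)
    {E : Type*} [NormedAddCommGroup E] [NormedSpace ℂ E] [CompleteSpace E]
    (ρ : H →ₗ[ℂ] H →ₗ⋆[ℂ] E) (hρ : ∀ x y, ‖ρ x y‖ = ‖x‖ * ‖y‖) {D : E →L[ℂ] E}
    (hD : ∀ x y, HasSum (fun j => ρ (A j x) (star (B j) y)) (D (ρ x y)))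
    {l m : J → ℂ} (hl : l ∈ jointSpectrum A) (hm : m ∈ jointSpectrum B) :
    ∑' j, l j * m j ∈ spectrum ℂ D := by
  obtain ⟨x, hx1, hx⟩ := exists_approx_joint_eigenvector hA hl
  obtain ⟨y, hy1, hy⟩ := exists_approx_joint_eigenvector hB hm
  have hlm := summable_mul_of_mem_jointSpectrum hA hB hl hm
  set z := ∑' j, l j * m j
  let f : ℕ → J → E := fun n j =>
    ρ (A j (x n)) (star (B j) (y n)) - (l j * m j) • ρ (x n) (y n)
  have hf : ∀ n, ∑' j, f n j = (D - algebraMap ℂ _ z) (ρ (x n) (y n)) := fun n =>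
    ((hD (x n) (y n)).sub (hlm.hasSum.smul_const _)).tsum_eq
  have hfe : ∀ n j, f n j = ρ (A j (x n) - l j • x n) (star (B j) (y n))
      + l j • ρ (x n) (star (B j) (y n) - (starRingEnd ℂ) (m j) • y n) := fun n j => by
    simp only [f, map_sub, map_smul, LinearMap.sub_apply, LinearMap.smul_apply,
      LinearMap.map_smulₛₗ, RingHomCompTriple.comp_apply, smul_sub,
      smul_smul]
    simp
  have hBy : ∀ n j, ‖star (B j) (y n)‖ ≤ ‖B j‖ := fun n j => by
    refine ((star (B j)).le_opNorm _).trans ?_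
    rw [hy1, norm_star, mul_one]
  have hAx : ∀ n j, ‖A j (x n)‖ ≤ ‖A j‖ := fun n j => by
    refine ((A j).le_opNorm _).trans ?_
    rw [hx1, mul_one]
  -- The approximation holds for each `j` separately, with no uniformity in `j`; dominated
  -- convergence with the bound `2 ‖A_j‖ ‖B_j‖` sums it.
  have hlim : Filter.Tendsto (fun n => ∑' j, f n j) Filter.atTop (nhds (∑' _ : J, (0 : E))) := by
    refine tendsto_tsum_of_dominated_convergence
      ((summable_norm_mul_norm hA hB).mul_left 2) (fun j => ?_)
      (Filter.Eventually.of_forall fun n j => ?_)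
    · have hb : ∀ n, ‖f n j‖ ≤ ‖A j (x n) - l j • x n‖ * ‖B j‖ +
          ‖l j‖ * ‖B j (y n) - m j • y n‖ := fun n => by
        rw [hfe]
        refine (norm_add_le _ _).trans ?_
        rw [norm_smul, hρ, hρ, norm_adjoint_sub_smul (hBn j), hx1, one_mul]
        gcongr
        exact hBy n j
      refine squeeze_zero_norm hb ?_
      simpa using ((hx j).norm.mul_const ‖B j‖).add ((hy j).norm.const_mul ‖l j‖)
    · refine (norm_sub_le _ _).trans ?_
      rw [norm_smul, hρ, hρ, hx1, hy1, norm_mul, two_mul]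
      simp only [mul_one]
      gcongr
      · exact hAx n j
      · exact hBy n j
      · exact norm_le_of_mem_jointSpectrum hl j
      · exact norm_le_of_mem_jointSpectrum hm j
  rw [tsum_zero] at hlim
  simp only [hf] at hlim
  rw [spectrum.mem_iff, ← IsUnit.neg_iff, neg_sub]
  -- A bounded inverse of `D - z` would send a null sequence to the vectors `ρ xₙ yₙ`, which have
  -- norm one.
  rintro ⟨u, hu⟩
  rw [← hu] at hlim
  have h2 := (((u⁻¹ : (E →L[ℂ] E)ˣ) : E →L[ℂ] E).continuous.tendsto _).comp hlim
  rw [map_zero] at h2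
  have h3 : ∀ n, ((u⁻¹ : (E →L[ℂ] E)ˣ) : E →L[ℂ] E) ((u : E →L[ℂ] E) (ρ (x n) (y n)))
      = ρ (x n) (y n) := fun n => by
    exact congrArg (fun T : E →L[ℂ] E => T (ρ (x n) (y n))) u.inv_mul
  have h4 := h2.norm
  simp [h3, hρ, hx1, hy1] at h4

/-! ### Left and right multiplications -/

/-- Upgrades the pointwise series to one convergent in operator norm, as required for `Δ` to lie in
a norm-closed algebra. -/
theorem hasSum_of_forall_hasSum_apply {E : Type*} [NormedAddCommGroup E] [NormedSpace ℂ E]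
    [CompleteSpace E] {F : J → E →L[ℂ] E} {D : E →L[ℂ] E} {b : J → ℝ} (hb : Summable b)
    (hF : ∀ j, ‖F j‖ ≤ b j) (hD : ∀ x, HasSum (fun j => F j x) (D x)) : HasSum F D := by
  have hs := Summable.of_norm_bounded hb hF
  have h : D = ∑' j, F j := ContinuousLinearMap.ext fun x =>
    (hD x).unique (hs.hasSum.mapL (ContinuousLinearMap.apply ℂ E x))
  exact h ▸ hs.hasSum

variable (H) in
/-- Left multiplication `X ↦ a X` on `B(H)`. -/
noncomputable def mulLeft : (H →L[ℂ] H) →ₗ[ℂ] ((H →L[ℂ] H) →L[ℂ] (H →L[ℂ] H)) :=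
  (ContinuousLinearMap.mul ℂ (H →L[ℂ] H)).toLinearMap

variable (H) in
/-- Right multiplication `X ↦ X b` on `B(H)`. -/
noncomputable def mulRight : (H →L[ℂ] H) →ₗ[ℂ] ((H →L[ℂ] H) →L[ℂ] (H →L[ℂ] H)) :=
  (ContinuousLinearMap.mul ℂ (H →L[ℂ] H)).flip.toLinearMap

theorem mulLeft_mul_mulRight_apply (a b X : H →L[ℂ] H) :
    (mulLeft H a * mulRight H b) X = a * X * b :=
  (mul_assoc a X b).symm

theorem hasSum_mulLeft_mul_mulRight (A B : J → H →L[ℂ] H)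
    (hA : Summable fun j => ‖A j‖ ^ 2) (hB : Summable fun j => ‖B j‖ ^ 2) :
    HasSum (fun j => mulLeft H (A j) * mulRight H (B j)) (multOp A B hA hB) := by
  refine hasSum_of_forall_hasSum_apply (summable_norm_mul_norm hA hB)
    (fun j => ContinuousLinearMap.opNorm_le_bound _ (by positivity) fun X => ?_) fun X => ?_
  · rw [mulLeft_mul_mulRight_apply]
    exact norm_mul_mul_le _ _ _
  · simp only [mulLeft_mul_mulRight_apply]
    exact hasSum_multOp A B hA hB X

theorem mul_rankOne {H : Type*} [NormedAddCommGroup H] [InnerProductSpace ℂ H]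
    (a : H →L[ℂ] H) (x y : H) :
    a * InnerProductSpace.rankOne ℂ x y = InnerProductSpace.rankOne ℂ (a x) y :=
  InnerProductSpace.comp_rankOne x y a

theorem rankOne_mul (b : H →L[ℂ] H) (x y : H) :
    InnerProductSpace.rankOne ℂ x y * b = InnerProductSpace.rankOne ℂ x (star b y) :=
  InnerProductSpace.rankOne_comp x y b

/-! ### Multiplications and rank one operators on `C₂` -/

namespace HilbertSchmidt

/-- The bounded operator `T ↦ S T R` on Hilbert-Schmidt operators. -/
noncomputable def mulMul (S R : H →L[ℂ] H) : HilbertSchmidt H →L[ℂ] HilbertSchmidt H :=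
  LinearMap.mkContinuous
    { toFun := hsMulMul S R
      map_add' := fun T U => incl_injective (by
        simp only [hsMulMul, map_add, incl_ofMem, mul_add, add_mul])
      map_smul' := fun c T => incl_injective (by
        simp only [hsMulMul, map_smul, incl_ofMem, RingHom.id_apply, mul_smul_comm,
          smul_mul_assoc]) }
    (‖S‖ * ‖R‖) (norm_hsMulMul_le S R)

theorem incl_mulMul (S R : H →L[ℂ] H) (T : HilbertSchmidt H) :
    incl H (mulMul S R T) = S * incl H T * R := rfl

theorem ext_incl {F G : HilbertSchmidt H →L[ℂ] HilbertSchmidt H}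
    (h : ∀ T, incl H (F T) = incl H (G T)) : F = G :=
  ContinuousLinearMap.ext fun T => incl_injective (h T)

theorem mulMul_mul_mulMul (S R S' R' : H →L[ℂ] H) :
    mulMul S R * mulMul S' R' = mulMul (S * S') (R' * R) :=
  ext_incl fun T => by
    change S * (S' * incl H T * R') * R = S * S' * incl H T * (R' * R)
    simp only [mul_assoc]

theorem mulMul_one_one : mulMul (1 : H →L[ℂ] H) 1 = 1 :=
  ext_incl fun _ => (mul_one _).trans (one_mul _)

variable (H) in
/-- Left multiplication `T ↦ a T` on the Hilbert-Schmidt operators. -/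
noncomputable def mulLeft : (H →L[ℂ] H) →ₗ[ℂ] (HilbertSchmidt H →L[ℂ] HilbertSchmidt H) where
  toFun a := mulMul a 1
  map_add' a b := ext_incl fun T => by
    simp only [add_apply, map_add, incl_mulMul, add_mul]
  map_smul' c a := ext_incl fun T => by
    simp only [smul_apply, map_smul, incl_mulMul, smul_mul_assoc,
      RingHom.id_apply]

variable (H) in
/-- Right multiplication `T ↦ T b` on the Hilbert-Schmidt operators. -/
noncomputable def mulRight : (H →L[ℂ] H) →ₗ[ℂ] (HilbertSchmidt H →L[ℂ] HilbertSchmidt H) where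
  toFun b := mulMul 1 b
  map_add' a b := ext_incl fun T => by
    simp only [add_apply, map_add, incl_mulMul, mul_add]
  map_smul' c a := ext_incl fun T => by
    simp only [smul_apply, map_smul, incl_mulMul, mul_smul_comm,
      RingHom.id_apply]

theorem mulLeft_mul_mulRight (a b : H →L[ℂ] H) : mulLeft H a * mulRight H b = mulMul a b :=
  (mulMul_mul_mulMul a 1 1 b).trans (by rw [mul_one, mul_one])

theorem mulRight_mul_mulLeft (a b : H →L[ℂ] H) : mulRight H b * mulLeft H a = mulMul a b :=
  (mulMul_mul_mulMul 1 b a 1).trans (by rw [one_mul, one_mul])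

theorem norm_incl_apply_basis_le (T : HilbertSchmidt H) (i : basisIndex H) :
    ‖incl H T (basis H i)‖ ≤ ‖T‖ :=
  lp.norm_apply_le_norm (p := 2) (by norm_num) (toLp H T) i

theorem eq_of_forall_basis {S T : HilbertSchmidt H}
    (h : ∀ i, incl H S (basis H i) = incl H T (basis H i)) : S = T :=
  toLp_injective (lp.ext (funext h))

/-- The value of `multOpHS` is defined by a series in operator norm, while the sum here is in the
Hilbert-Schmidt norm. Evaluation at a basis vector is continuous for both norms, and these
evaluations identify the two limits. -/
theorem hasSum_mulMul (A B : J → H →L[ℂ] H)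
    (hA : Summable fun j => ‖A j‖ ^ 2) (hB : Summable fun j => ‖B j‖ ^ 2) :
    HasSum (fun j => mulMul (A j) (B j)) (multOpHS A B hA hB) := by
  refine hasSum_of_forall_hasSum_apply (summable_norm_mul_norm hA hB)
    (fun j => LinearMap.mkContinuous_norm_le _ (by positivity) _) fun T => ?_
  have hs : Summable fun j => mulMul (A j) (B j) T :=
    Summable.of_norm_bounded ((summable_norm_mul_norm hA hB).mul_right ‖T‖)
      fun j => norm_hsMulMul_le _ _ _
  convert hs.hasSum
  refine eq_of_forall_basis fun i => ?_
  let e : HilbertSchmidt H →L[ℂ] H := LinearMap.mkContinuous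
    ((ContinuousLinearMap.apply ℂ H (basis H i)).toLinearMap ∘ₗ incl H) 1
    fun T => by rw [one_mul]; exact norm_incl_apply_basis_le T i
  exact ((hasSum_multOp A B hA hB (incl H T)).mapL
    (ContinuousLinearMap.apply ℂ H (basis H i))).unique (hs.hasSum.mapL e)

theorem hsSq_rankOne (x y : H) :
    hsSq (MultiplicationOperators.basis H) (InnerProductSpace.rankOne ℂ x y)
      = (‖x‖ₑ * ‖y‖ₑ) ^ 2 := by
  rw [hsSq_adjoint _ (MultiplicationOperators.basis H), ContinuousLinearMap.star_eq_adjoint,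
    InnerProductSpace.adjoint_rankOne, hsSq]
  simp only [InnerProductSpace.rankOne_apply, enorm_smul, mul_pow]
  rw [ENNReal.tsum_mul_right, ← tsum_enorm_inner_sq (MultiplicationOperators.basis H) x]
  congr 1
  refine tsum_congr fun i => ?_
  rw [← inner_conj_symm, RCLike.enorm_conj]

theorem rankOne_mem (x y : H) : InnerProductSpace.rankOne ℂ x y ∈ hsSubmodule H := by
  rw [mem_hsSubmodule_iff (MultiplicationOperators.basis H), summable_iff_hsSq_lt_top, hsSq_rankOne]
  exact ENNReal.pow_lt_top (ENNReal.mul_lt_top enorm_lt_top enorm_lt_top)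

variable (H) in
/-- The rank one operator `z ↦ ⟪y, z⟫ x` as a Hilbert-Schmidt operator. -/
noncomputable def rankOne : H →ₗ[ℂ] H →ₗ⋆[ℂ] HilbertSchmidt H :=
  LinearMap.mk₂'ₛₗ (RingHom.id ℂ) (starRingEnd ℂ)
    (fun x y => ofMem (InnerProductSpace.rankOne ℂ x y) (rankOne_mem x y))
    (fun x x' y => incl_injective (by simp only [incl_ofMem, map_add, add_apply]))
    (fun c x y => incl_injective (by
      simp only [incl_ofMem, map_smul, smul_apply, RingHom.id_apply]))
    (fun x y y' => incl_injective (by simp only [incl_ofMem, map_add]))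
    (fun c x y => incl_injective (by simp only [incl_ofMem, map_smul, map_smulₛₗ]))

/-- The Hilbert-Schmidt norm agrees with the operator norm on rank one operators, so the same
approximate eigenvectors serve on `C₂`. -/
theorem norm_rankOne (x y : H) : ‖rankOne H x y‖ = ‖x‖ * ‖y‖ := by
  have h := ofReal_norm_sq (rankOne H x y)
  change _ = hsSq _ (InnerProductSpace.rankOne ℂ x y) at h
  rw [hsSq_rankOne, ← ofReal_norm, ← ofReal_norm, ← ENNReal.ofReal_mul (norm_nonneg _),
    ← ENNReal.ofReal_pow (by positivity), ENNReal.ofReal_eq_ofReal_iff (by positivity)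
    (by positivity)] at h
  exact (pow_left_inj₀ (norm_nonneg _) (by positivity) two_ne_zero).1 h

theorem mulMul_rankOne (a b : H →L[ℂ] H) (x y : H) :
    mulMul a b (rankOne H x y) = rankOne H (a x) (star b y) :=
  incl_injective (by
    change a * InnerProductSpace.rankOne ℂ x y * b = InnerProductSpace.rankOne ℂ (a x) (star b y)
    rw [mul_rankOne, rankOne_mul])

end HilbertSchmidt

/-! ### The spectra of the multiplication operators -/

theorem spectrum_multOp {A B : J → H →L[ℂ] H}
    (hAn : ∀ j, IsStarNormal (A j)) (hBn : ∀ j, IsStarNormal (B j))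
    (hAc : ∀ i j, Commute (A i) (A j)) (hBc : ∀ i j, Commute (B i) (B j))
    (hA : Summable fun j => ‖A j‖ ^ 2) (hB : Summable fun j => ‖B j‖ ^ 2) :
    spectrum ℂ (multOp A B hA hB) =
      {z | ∃ l ∈ jointSpectrum A, ∃ m ∈ jointSpectrum B, z = ∑' j, l j * m j} := by
  ext z
  constructor
  · intro hz
    refine exists_jointSpectrum_of_mem_spectrum hAn hBn hAc hBc (mulLeft H) (mulRight H)
      ?_ ?_ ?_ ?_ ?_ (hasSum_mulLeft_mul_mulRight A B hA hB) hz
    · exact ContinuousLinearMap.ext fun X => one_mul X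
    · exact ContinuousLinearMap.ext fun X => mul_one X
    · exact fun a b => ContinuousLinearMap.ext fun X => mul_assoc a b X
    · exact fun a b => ContinuousLinearMap.ext fun X => (mul_assoc X a b).symm
    · exact fun a b => ContinuousLinearMap.ext fun X => (mul_assoc a X b).symm
  · rintro ⟨l, hl, m, hm, rfl⟩
    let ρ : H →ₗ[ℂ] H →ₗ⋆[ℂ] (H →L[ℂ] H) :=
      LinearMap.mk₂'ₛₗ (RingHom.id ℂ) (starRingEnd ℂ) (fun x y => InnerProductSpace.rankOne ℂ x y)
        (fun x x' y => by simp only [map_add, add_apply])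
        (fun c x y => by simp only [map_smul, smul_apply, RingHom.id_apply])
        (fun x y y' => by simp only [map_add])
        (fun c x y => by simp only [map_smulₛₗ])
    refine mem_spectrum_of_jointSpectrum hBn hA hB ρ
      (fun x y => InnerProductSpace.norm_rankOne x y) (fun x y => ?_) hl hm
    refine (congrArg (fun g => HasSum g _) (funext fun j => ?_)).mpr
      (hasSum_multOp A B hA hB (ρ x y))
    change InnerProductSpace.rankOne ℂ (A j x) (star (B j) y)
      = A j * InnerProductSpace.rankOne ℂ x y * B j
    rw [mul_rankOne, rankOne_mul]

theorem spectrum_multOpHS {A B : J → H →L[ℂ] H}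
    (hAn : ∀ j, IsStarNormal (A j)) (hBn : ∀ j, IsStarNormal (B j))
    (hAc : ∀ i j, Commute (A i) (A j)) (hBc : ∀ i j, Commute (B i) (B j))
    (hA : Summable fun j => ‖A j‖ ^ 2) (hB : Summable fun j => ‖B j‖ ^ 2) :
    spectrum ℂ (multOpHS A B hA hB) =
      {z | ∃ l ∈ jointSpectrum A, ∃ m ∈ jointSpectrum B, z = ∑' j, l j * m j} := by
  have hsum := HilbertSchmidt.hasSum_mulMul A B hA hB
  ext z
  constructor
  · intro hz
    refine exists_jointSpectrum_of_mem_spectrum hAn hBn hAc hBc (HilbertSchmidt.mulLeft H)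
      (HilbertSchmidt.mulRight H) HilbertSchmidt.mulMul_one_one HilbertSchmidt.mulMul_one_one
      (fun a b => ?_) (fun a b => ?_) (fun a b => ?_)
      (by simpa only [HilbertSchmidt.mulLeft_mul_mulRight] using hsum) hz
    · exact ((HilbertSchmidt.mulMul_mul_mulMul a 1 b 1).trans (by rw [mul_one]; rfl)).symm
    · exact ((HilbertSchmidt.mulMul_mul_mulMul 1 b 1 a).trans (by rw [mul_one]; rfl)).symm
    · rw [HilbertSchmidt.mulLeft_mul_mulRight, HilbertSchmidt.mulRight_mul_mulLeft]
  · rintro ⟨l, hl, m, hm, rfl⟩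
    refine mem_spectrum_of_jointSpectrum hBn hA hB (HilbertSchmidt.rankOne H)
      HilbertSchmidt.norm_rankOne (fun x y => ?_) hl hm
    simp only [← HilbertSchmidt.mulMul_rankOne]
    exact hsum.mapL (ContinuousLinearMap.apply ℂ _ (HilbertSchmidt.rankOne H x y))

end MultiplicationOperators

theorem mainTheorem7 {J : Type*} [Countable J]
    {H : Type*} [NormedAddCommGroup H] [InnerProductSpace ℂ H] [CompleteSpace H]
    (A B : J → H →L[ℂ] H)
    (hAn : ∀ j, IsStarNormal (A j)) (hBn : ∀ j, IsStarNormal (B j))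
    (hAc : ∀ i j, Commute (A i) (A j)) (hBc : ∀ i j, Commute (B i) (B j))
    (hA : Summable fun j => ‖A j‖ ^ 2) (hB : Summable fun j => ‖B j‖ ^ 2) :
    spectrum ℂ (MultiplicationOperators.multOp A B hA hB) =
        {z | ∃ l ∈ MultiplicationOperators.jointSpectrum A, ∃ m ∈ MultiplicationOperators.jointSpectrum B, z = ∑' j, l j * m j} ∧
      {z | ∃ l ∈ MultiplicationOperators.jointSpectrum A, ∃ m ∈ MultiplicationOperators.jointSpectrum B, z = ∑' j, l j * m j} =
        spectrum ℂ (MultiplicationOperators.multOpHS A B hA hB) := by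
  have h := MultiplicationOperators.spectrum_multOp hAn hBn hAc hBc hA hB
  exact ⟨h, (MultiplicationOperators.spectrum_multOpHS hAn hBn hAc hBc hA hB).symm⟩
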